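/- Let $r=(r_n)$, $s=(s_n)$, $t=(t_n)$, $n\ge 0$, be sequences of real (or of complex) numbers with $r_n\neq0$, $t_n\ne0$ for all $n$ and $s_0\neq 0$, and let $p=(p_k)_{k\ge0}$ be a bounded sequence of strictly positive real numbers. Put $\Delta x_k=x_k-x_{k-1}$ with $x_{-1}=0$ and $$l(r,s,t,p;\Delta)=\Big\{x=(x_k)_{k\ge 0}:\ \sum_{n=0}^\infty\Big|\frac1{r_n}\sum_{k=0}^n s_{n-k}t_k\,\Delta x_k\Big|^{p_n}<\infty\Big\}.$$ Its $\beta$-dual $[l(r,s,t,p;\Delta)]^\beta$ is the set of all sequences $a=(a_k)$ such that $\sum_k a_kx_k$ converges for every $x\in l(r,s,t,p;\Delta)$. For an infinite matrix $A=(a_{nk})_{n,k\ge0}$ write $A\in(l(r,s,t,p;\Delta),l_1)$ if for every $x\in l(r,s,t,p;\Delta)$ all the series $(Ax)_n=\sum_k a_{nk}x_k$ converge and $\sum_n|(Ax)_n|<\infty$. Let $D^{(s)}_0=1/s_0$ and, for $n\ge1$, let $D_n^{(s)}=s_0^{-(n+1)}\det\big(s_{i-j+1}\big)_{1\le i,j\le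 n}$, where $s_m=0$ for $m<0$. For a sequence $a=(a_k)$ let $E(a)=(e_{mk})_{m,k\ge0}$, where $e_{mk}=0$ for $k>m$ and, for $0\le k\le m$, $$e_{mk}=r_k\Big[\frac{a_k}{s_0t_k}+\Big(\frac{D_0^{(s)}}{t_k}-\frac{D_1^{(s)}}{t_{k+1}}\Big)\sum_{j=k+1}^m a_j+\sum_{l=k+2}^m(-1)^{l-k}\frac{D_{l-k}^{(s)}}{t_l}\sum_{j=l}^m a_j\Big].$$ For a matrix $A$ let $\tilde e_{nk}=\lim_{m\to\infty}e^{(n)}_{mk}$, where $(e^{(n)}_{mk})_{m,k}=E\big((a_{nj})_{j}\big)$ is built from the $n$-th row of $A$; by the descriptions of the $\beta$-dual below, this limit exists if that row lies in $[l(r,s,t,p;\Delta)]^\beta$. Below, $F$ ranges over the finite subsets of $\{0,1,2,\dots\}$, and $\mathbb N=\{1,2,\dots\}$. Consider the conditions on a sequence $a$, with $(e_{mk})=E(a)$: * $(B_3)$ $\sup_k|r_ka_k/t_k|^{p_k}<\infty$; * $(B_4)$ $\sup_m\sum_k|e_{mk}L^{-1}|^{p_k'}<\infty$ for some $L\in\mathbb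 N$, where $p_k'=p_k/(p_k-1)$ (used only if all $p_k>1$); * $(B_5)$ $\sup_{m,k}|e_{mk}|^{p_k}<\infty$; * $(B_6)$ $\lim_{m\to\infty}e_{mk}$ exists for every $k$; * $(B_7)$ for every $L\in\mathbb N$ there is a sequence $(\alpha_k)$ with $\sup_{m,k}(|e_{mk}-\alpha_k|L)^{p_k}<\infty$. **(a)** Let $p_k>1$ for all $k$. Then $a\in[l(r,s,t,p;\Delta)]^\beta$ if and only if $a$ satisfies $(B_3)$, $(B_4)$ and $(B_6)$. Moreover $A\in(l(r,s,t,p;\Delta),l_1)$ if and only if $$\sup_F\sum_{k=0}^\infty\Big|\sum_{n\in F}\tilde e_{nk}L^{-1}\Big|^{p_k'}<\infty\ \text{ for some }L\in\mathbb N\quad\text{and}\quad (a_{nk})_{k}\in[l(r,s,t,p;\Delta)]^\beta\ \text{ for every }n.$$ **(b)** Let $0<p_k\le1$ for all $k$. Then $a\in[l(r,s,t,p;\Delta)]^\beta$ if and only if $a$ satisfies $(B_3)$, $(B_5)$, $(B_6)$ and $(B_7)$. Moreover $A\in(l(r,s,t,p;\Delta),l_1)$ if and only if $$\sup_F\sup_k\Big|\sum_{n\in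 F}\tilde e_{nk}\Big|^{p_k}<\infty\quad\text{and}\quad (a_{nk})_{k}\in[l(r,s,t,p;\Delta)]^\beta\ \text{ for every }n.$$ -/

import Mathlib

open Filter Topology

namespace GenMeans

noncomputable section

variable {𝕜 : Type*} [RCLike 𝕜]

/-- The Maddox space `l(p)`. -/
def maddoxL (p : ℕ → ℝ) : Set (ℕ → 𝕜) :=
  {x | Summable fun k => ‖x k‖ ^ p k}

/-- The Maddox space `l_∞(p)`. -/
def maddoxLinf (p : ℕ → ℝ) : Set (ℕ → 𝕜) :=
  {x | (⨆ k, ENNReal.ofReal (‖x k‖ ^ p k)) < ⊤}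

/-- The space `l₁` of absolutely summable sequences. -/
def ell1 : Set (ℕ → 𝕜) :=
  {x | Summable fun k => ‖x k‖}

/-- The series `∑_{k ≥ 0} x k` converges (possibly conditionally) to `v`. -/
def SeriesConvTo (x : ℕ → 𝕜) (v : 𝕜) : Prop :=
  Tendsto (fun m => ∑ k ∈ Finset.range (m + 1), x k) atTop (𝓝 v)

/-- The space `cs` of convergent series. -/
def cs : Set (ℕ → 𝕜) :=
  {x | ∃ v, SeriesConvTo x v}

/-- The `β`-dual of a set of sequences. -/
def betaDual (U : Set (ℕ → 𝕜)) : Set (ℕ → 𝕜) :=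
  {a | ∀ x ∈ U, (fun k => a k * x k) ∈ cs}

/-- The class `(U, V)` of infinite matrices `A` such that for every `x ∈ U` all the series
`(A x)_n = ∑_k a_{nk} x_k` converge and `A x ∈ V`. -/
def matrixClass (U V : Set (ℕ → 𝕜)) : Set (ℕ → ℕ → 𝕜) :=
  {A | ∀ x ∈ U, ∃ z ∈ V, ∀ n, SeriesConvTo (fun k => A n k * x k) (z n)}

/-- The difference operator `(Δ x)_k = x_k - x_{k-1}`, with `x_{-1} = 0`. -/
def diff (x : ℕ → 𝕜) : ℕ → 𝕜
  | 0 => x 0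
  | k + 1 => x (k + 1) - x k

/-- The generalized means `y_n = (1 / r_n) ∑_{k=0}^n s_{n-k} t_k x_k`. -/
def genMean (r s t x : ℕ → 𝕜) (n : ℕ) : 𝕜 :=
  (1 / r n) * ∑ k ∈ Finset.range (n + 1), s (n - k) * t k * x k

/-- The space `l(r, s, t, p; Δ)`. -/
def lSpace (r s t : ℕ → 𝕜) (p : ℕ → ℝ) : Set (ℕ → 𝕜) :=
  {x | genMean r s t (diff x) ∈ maddoxL p}

/-- `D_n^{(s)} = s_0^{-(n+1)}` times the `n × n` determinant with entries `s_{i-j+1}`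
(zero for `j > i + 1`); in particular `D_0^{(s)} = 1 / s_0`. -/
def D (s : ℕ → 𝕜) (n : ℕ) : 𝕜 :=
  (1 / s 0 ^ (n + 1)) *
    (Matrix.of fun i j : Fin n =>
      if (j : ℕ) ≤ (i : ℕ) + 1 then s ((i : ℕ) + 1 - (j : ℕ)) else 0).det

/-- The matrix `E = (e_{mk})` associated with a sequence `a`. -/
def E (r s t a : ℕ → 𝕜) (m k : ℕ) : 𝕜 :=
  if k ≤ m then
    r k * (a k / (s 0 * t k)
      + (D s 0 / t k - D s 1 / t (k + 1)) * ∑ j ∈ Finset.Icc (k + 1) m, a j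
      + ∑ l ∈ Finset.Icc (k + 2) m,
          (-1) ^ (l - k) * (D s (l - k) / t l) * ∑ j ∈ Finset.Icc l m, a j)
  else 0

/-- The matrix `Ẽ = (ẽ_{nk})`, where `ẽ_{nk}` is the limit as `m → ∞` of the entry `e_{mk}` of the
matrix `E` associated with the `n`-th row of `A`. The limit exists whenever that row is in the set
`setB6` below. -/
def Etilde (r s t : ℕ → 𝕜) (A : ℕ → ℕ → 𝕜) (n k : ℕ) : 𝕜 :=
  limUnder atTop fun m => E r s t (A n) m k

/-- The conjugate exponent `p' = p / (p - 1)`, used for `p > 1`. -/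
def conjExp (p : ℝ) : ℝ := p / (p - 1)

def setB3 (r t : ℕ → 𝕜) (p : ℕ → ℝ) : Set (ℕ → 𝕜) :=
  {a | (fun k => r k * a k / t k) ∈ maddoxLinf p}

def setB4 (r s t : ℕ → 𝕜) (p : ℕ → ℝ) : Set (ℕ → 𝕜) :=
  {a | ∃ L : ℕ, 0 < L ∧
    (⨆ m, ∑' k, ENNReal.ofReal (‖E r s t a m k * (L : 𝕜)⁻¹‖ ^ conjExp (p k))) < ⊤}

def setB5 (r s t : ℕ → 𝕜) (p : ℕ → ℝ) : Set (ℕ → 𝕜) :=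
  {a | (⨆ m, ⨆ k, ENNReal.ofReal (‖E r s t a m k‖ ^ p k)) < ⊤}

def setB6 (r s t : ℕ → 𝕜) : Set (ℕ → 𝕜) :=
  {a | ∃ α : ℕ → 𝕜, ∀ k, Tendsto (fun m => E r s t a m k) atTop (𝓝 (α k))}

def setB7 (r s t : ℕ → 𝕜) (p : ℕ → ℝ) : Set (ℕ → 𝕜) :=
  {a | ∀ L : ℕ, 0 < L → ∃ α : ℕ → 𝕜,
    (⨆ m, ⨆ k, ENNReal.ofReal ((‖E r s t a m k - α k‖ * L) ^ p k)) < ⊤}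

end

end GenMeans

/-! Write `y = genMean r s t (diff x)`. The space is by definition the set of `x` with `y` in the
Maddox space `l(p)`, and every `y` arises because `s 0`, `r n`, `t n` are nonzero. Inverting the
Toeplitz matrix of `s` (`mul_diff_eq`) and summing by parts gives `∑_{k ≤ m} a k * x k = ∑_k e_{mk}
y_k` (`sum_mul_eq_sum_E_mul`). So `a` lies in the β-dual exactly when `∑_k e_{mk} y_k` converges as
`m → ∞` for every `y` in `l(p)`.

Two properties of a family of functionals on `l(p)` govern this: `BddNearZero`, boundedness on some
modular ball, and `EquiSmall`, equicontinuity at 0. Pointwise boundedness implies the first, by a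
gliding hump (`bddNearZero_of_pointwise_bounded`). The second, with columnwise convergence, gives
convergence at every `y` (`EquiSmall.tendsto_tsum`). The coefficient condition closes the circle:
`BddNearZero` implies `ConjBounded` (for `p k > 1`) or `PowBounded` (for `p k ≤ 1`), and each of
these implies `EquiSmall`.

Conditions B3 and B7 follow from B4 or B5. For maps into `l₁` the same scheme is applied to the
family of sums over finite sets `F` of rows of `Etilde`, since a scalar sequence is absolutely
summable as soon as its finite partial sums are bounded (`mem_ell1_of_bounded_sums`). -/

namespace GenMeans

/-! ### Inversion of the generalized means and summation by parts. -/

section Algebra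

variable {𝕜 : Type*} [RCLike 𝕜]

/-- The lower triangular Toeplitz matrix of size `n + 1` built from `s`. -/
def toeplitz (s : ℕ → 𝕜) (n : ℕ) : Matrix (Fin (n + 1)) (Fin (n + 1)) 𝕜 :=
  Matrix.of fun i j => if (j : ℕ) ≤ (i : ℕ) then s ((i : ℕ) - (j : ℕ)) else 0

lemma det_toeplitz (s : ℕ → 𝕜) (n : ℕ) : (toeplitz s n).det = s 0 ^ (n + 1) := by
  rw [Matrix.det_of_isLowerTriangular]
  · simp [toeplitz]
  · intro i j hij
    have : (i : ℕ) < j := hij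
    exact if_neg this.not_ge

/-- Deleting the first row and the last column of the Toeplitz matrix leaves precisely the
Hessenberg matrix whose determinant defines `D s n`. -/
lemma adjugate_toeplitz (s : ℕ → 𝕜) (n : ℕ) (hs : s 0 ≠ 0) :
    (toeplitz s n).adjugate (Fin.last n) 0 = s 0 ^ (n + 1) * ((-1) ^ n * D s n) := by
  rw [Matrix.adjugate_fin_succ_eq_det_submatrix]
  have h : (toeplitz s n).submatrix (Fin.succAbove 0) (Fin.succAbove (Fin.last n)) =
      Matrix.of fun i j : Fin n =>
        if (j : ℕ) ≤ (i : ℕ) + 1 then s ((i : ℕ) + 1 - (j : ℕ)) else 0 := by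
    ext i j
    simp only [toeplitz, Matrix.submatrix_apply, Matrix.of_apply, Fin.succAbove_zero,
      Fin.succAbove_last, Fin.val_succ, Fin.val_castSucc]
  rw [h, D]
  have := pow_ne_zero (n + 1) hs
  field_simp
  simp [mul_comm]

/-- The numbers `(-1)^n D_n` are the coefficients of the reciprocal power series. -/
lemma coeff_inv_mk (s : ℕ → 𝕜) (hs : s 0 ≠ 0) (n : ℕ) :
    PowerSeries.coeff n (PowerSeries.mk s)⁻¹ = (-1) ^ n * D s n := by
  set c : ℕ → 𝕜 := fun k => PowerSeries.coeff k (PowerSeries.mk s)⁻¹ with hc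
  have hinv : (PowerSeries.mk s)⁻¹ * PowerSeries.mk s = 1 :=
    PowerSeries.inv_mul_cancel _ (by simpa using hs)
  have hmul : (toeplitz s n).mulVec (fun i => c i) = Pi.single 0 1 := by
    ext i
    have h1 := congrArg (PowerSeries.coeff (i : ℕ)) hinv
    rw [PowerSeries.coeff_mul, Finset.Nat.sum_antidiagonal_eq_sum_range_succ_mk,
      PowerSeries.coeff_one] at h1
    simp only [PowerSeries.coeff_mk] at h1
    simp only [Matrix.mulVec, dotProduct, toeplitz, Matrix.of_apply, Pi.single_apply, Fin.ext_iff,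
      Fin.val_zero]
    rw [← h1, Fin.sum_univ_eq_sum_range
      (fun j => (if j ≤ (i : ℕ) then s ((i : ℕ) - j) else 0) * c j) (n + 1)]
    have hsub : Finset.range ((i : ℕ) + 1) ⊆ Finset.range (n + 1) :=
      Finset.range_subset_range.2 i.isLt
    rw [← Finset.sum_subset hsub]
    · refine Finset.sum_congr rfl fun j hj => ?_
      rw [if_pos (by simpa [Nat.lt_succ_iff] using hj), mul_comm]
    · intro j _ hj
      rw [if_neg (by simpa [Nat.lt_succ_iff] using hj), zero_mul]
  -- Cramer's rule for the last unknown: the system `hmul` has right-hand side `e_0`, so only the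
  -- corner entry of the adjugate survives.
  have h2 := congrArg (fun v => (toeplitz s n).adjugate.mulVec v (Fin.last n)) hmul
  simp only [Matrix.mulVec_mulVec, Matrix.adjugate_mul, det_toeplitz, Matrix.smul_mulVec,
    Matrix.one_mulVec, Matrix.mulVec_single_one, Pi.smul_apply, smul_eq_mul, Fin.val_last,
    Matrix.col_apply, adjugate_toeplitz s n hs] at h2
  exact mul_left_cancel₀ (pow_ne_zero _ hs) h2

lemma sum_range_mul_eq_coeff (s z : ℕ → 𝕜) (n : ℕ) :
    ∑ k ∈ Finset.range (n + 1), s (n - k) * z k =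
      PowerSeries.coeff n (PowerSeries.mk s * PowerSeries.mk z) := by
  rw [mul_comm, PowerSeries.coeff_mul, Finset.Nat.sum_antidiagonal_eq_sum_range_succ_mk]
  exact Finset.sum_congr rfl fun k _ => by simp [mul_comm]

lemma mul_diff_eq (r s t x : ℕ → 𝕜) (hr : ∀ n, r n ≠ 0) (hs : s 0 ≠ 0) (l : ℕ) :
    t l * diff x l = ∑ i ∈ Finset.range (l + 1),
      (-1) ^ (l - i) * D s (l - i) * (r i * genMean r s t (diff x) i) := by
  have h : PowerSeries.mk s * PowerSeries.mk (fun k => t k * diff x k) =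
      PowerSeries.mk fun n => r n * genMean r s t (diff x) n := by
    ext n
    rw [← sum_range_mul_eq_coeff, PowerSeries.coeff_mk, genMean, ← mul_assoc, mul_one_div_cancel (hr n),
      one_mul]
    simp [mul_assoc]
  have h2 : PowerSeries.mk (fun k => t k * diff x k) = (PowerSeries.mk s)⁻¹ *
      PowerSeries.mk fun n => r n * genMean r s t (diff x) n := by
    rw [← h, ← mul_assoc, PowerSeries.inv_mul_cancel _ (by simpa using hs), one_mul]
  have h3 := congrArg (PowerSeries.coeff l) h2
  rw [PowerSeries.coeff_mk] at h3
  rw [h3, mul_comm, PowerSeries.coeff_mul, Finset.Nat.sum_antidiagonal_eq_sum_range_succ_mk]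
  refine Finset.sum_congr rfl fun i _ => ?_
  simp only [PowerSeries.coeff_mk, coeff_inv_mk s hs]
  ring

lemma sum_diff (x : ℕ → 𝕜) (n : ℕ) : ∑ k ∈ Finset.range (n + 1), diff x k = x n := by
  induction n with
  | zero => simp [diff]
  | succ n ih => rw [Finset.sum_range_succ, ih, diff]; ring

lemma diff_sum (d : ℕ → 𝕜) : diff (fun n => ∑ k ∈ Finset.range (n + 1), d k) = d := by
  ext n
  cases n with
  | zero => simp [diff]
  | succ n => rw [diff, Finset.sum_range_succ _ (n + 1)]; ring

lemma exists_genMean_diff_eq (r s t : ℕ → 𝕜) (hr : ∀ n, r n ≠ 0) (ht : ∀ n, t n ≠ 0)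
    (hs : s 0 ≠ 0) (y : ℕ → 𝕜) : ∃ x, genMean r s t (diff x) = y := by
  set w := (PowerSeries.mk s)⁻¹ * PowerSeries.mk fun n => r n * y n with hw
  refine ⟨fun n => ∑ k ∈ Finset.range (n + 1), PowerSeries.coeff k w / t k, ?_⟩
  rw [diff_sum]
  ext n
  have h : ∑ k ∈ Finset.range (n + 1), s (n - k) * t k * (PowerSeries.coeff k w / t k) =
      ∑ k ∈ Finset.range (n + 1), s (n - k) * PowerSeries.coeff k w :=
    Finset.sum_congr rfl fun k _ => by have := ht k; field_simp
  rw [genMean, h, sum_range_mul_eq_coeff]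
  have h2 : PowerSeries.mk (fun k => PowerSeries.coeff k w) = w := by ext; simp
  rw [h2, hw, ← mul_assoc, PowerSeries.mul_inv_cancel _ (by simpa using hs), one_mul,
    PowerSeries.coeff_mk, one_div, inv_mul_cancel_left₀ (hr n)]

lemma sum_Icc_eq_add_sum_succ {k m : ℕ} (h : k ≤ m) (f : ℕ → 𝕜) :
    ∑ l ∈ Finset.Icc k m, f l = f k + ∑ l ∈ Finset.Icc (k + 1) m, f l := by
  rw [← Finset.add_sum_Ioc_eq_sum_Icc h]
  congr 2
  ext
  simp

/-- The definition of `E` splits off the terms `l = k` and `l = k + 1`; merging them into one sum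
gives the form that an interchange of summation produces. -/
lemma E_eq (r s t a : ℕ → 𝕜) (m k : ℕ) :
    E r s t a m k = r k * ∑ l ∈ Finset.Icc k m,
      (-1) ^ (l - k) * (D s (l - k) / t l) * ∑ j ∈ Finset.Icc l m, a j := by
  rw [E]
  split_ifs with h
  · have h0 : D s 0 = 1 / s 0 := by simp [D]
    rw [sum_Icc_eq_add_sum_succ h (fun l => _ * ∑ j ∈ Finset.Icc l m, a j),
      sum_Icc_eq_add_sum_succ h a]
    rcases h.eq_or_lt with rfl | h'
    · simp [h0]
      left
      ring
    · rw [sum_Icc_eq_add_sum_succ (k := k + 1) h' (fun l => _ * ∑ j ∈ Finset.Icc l m, a j)]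
      have h1 : k + 1 - k = 1 := by omega
      simp only [Nat.sub_self, pow_zero, one_mul, h1, pow_one]
      rw [h0, ← div_div, add_assoc k 1 1]
      ring
  · rw [Finset.Icc_eq_empty h]
    simp

lemma E_of_lt (r s t a : ℕ → 𝕜) {m k : ℕ} (h : m < k) : E r s t a m k = 0 := by
  simp [E, h.not_ge]

lemma E_self (r s t a : ℕ → 𝕜) (k : ℕ) : E r s t a k k = (s 0)⁻¹ * (r k * a k / t k) := by
  simp [E]
  ring

lemma sum_mul_eq_sum_E_mul (r s t a x : ℕ → 𝕜) (hr : ∀ n, r n ≠ 0) (ht : ∀ n, t n ≠ 0)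
    (hs : s 0 ≠ 0) (m : ℕ) :
    ∑ k ∈ Finset.range (m + 1), a k * x k =
      ∑ k ∈ Finset.range (m + 1), E r s t a m k * genMean r s t (diff x) k := by
  have h1 : ∑ k ∈ Finset.range (m + 1), a k * x k =
      -- Abel summation: `x k` is replaced by the sum of its differences and the order of summation
      -- is exchanged.
      ∑ l ∈ Finset.range (m + 1), ∑ k ∈ Finset.Icc l m, a k * diff x l := by
    rw [Finset.sum_comm' (t' := Finset.range (m + 1)) (s' := fun k => Finset.range (k + 1))]
    · exact Finset.sum_congr rfl fun k _ => by rw [← Finset.mul_sum, sum_diff]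
    · intro i j
      simp only [Finset.mem_range, Finset.mem_Icc]
      omega
  have h2 : ∀ l, diff x l = (∑ i ∈ Finset.range (l + 1),
      (-1) ^ (l - i) * D s (l - i) * (r i * genMean r s t (diff x) i)) / t l := fun l => by
    rw [← mul_diff_eq r s t x hr hs l, mul_div_cancel_left₀ _ (ht l)]
  have h3 : ∑ l ∈ Finset.range (m + 1), ∑ k ∈ Finset.Icc l m, a k * diff x l =
      ∑ l ∈ Finset.range (m + 1), ∑ i ∈ Finset.range (l + 1),
        (r i * ((-1) ^ (l - i) * (D s (l - i) / t l) * ∑ j ∈ Finset.Icc l m, a j)) *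
          genMean r s t (diff x) i := by
    refine Finset.sum_congr rfl fun l _ => ?_
    rw [← Finset.sum_mul]
    conv_lhs => rw [h2 l]
    rw [Finset.sum_div, Finset.mul_sum]
    exact Finset.sum_congr rfl fun i _ => by ring
  rw [h1, h3, Finset.sum_comm' (t' := Finset.range (m + 1)) (s' := fun i => Finset.Icc i m)]
  · refine Finset.sum_congr rfl fun i _ => ?_
    rw [E_eq, Finset.mul_sum, Finset.sum_mul]
  · intro i j
    simp only [Finset.mem_range, Finset.mem_Icc]
    omega

end Algebra

/-! ### Equicontinuous families of functionals on `l(p)`. -/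

section Equicontinuity

variable {𝕜 : Type*} [RCLike 𝕜] {ι : Type*} {p : ℕ → ℝ}

/-- The functionals `y ↦ ∑ k, c i k * y k` are, in absolute value, equicontinuous at `0` with
respect to the modular `∑ k, ‖y k‖ ^ p k`. -/
def EquiSmall (p : ℕ → ℝ) (c : ι → ℕ → 𝕜) : Prop :=
  ∀ ε > 0, ∃ ρ > 0, ∀ i (S : Finset ℕ) (y : ℕ → 𝕜),
    ∑ k ∈ S, ‖y k‖ ^ p k ≤ ρ → ∑ k ∈ S, ‖c i k * y k‖ ≤ ε

/-- `EquiSmall` for a single functional. -/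
def RowSmall (p : ℕ → ℝ) (c : ℕ → 𝕜) : Prop :=
  EquiSmall p fun _ : Unit => c

/-- The functionals `y ↦ ∑ k, c i k * y k` are uniformly bounded on some ball of the modular
`∑ k, ‖y k‖ ^ p k`. -/
def BddNearZero (p : ℕ → ℝ) (c : ι → ℕ → 𝕜) : Prop :=
  ∃ ρ > 0, ∃ C, ∀ i (S : Finset ℕ) (y : ℕ → 𝕜),
    ∑ k ∈ S, ‖y k‖ ^ p k ≤ ρ → ‖∑ k ∈ S, c i k * y k‖ ≤ C

lemma exists_finset_sum_le {y : ℕ → 𝕜} (hy : y ∈ maddoxL p) {ρ : ℝ} (hρ : 0 < ρ) :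
    ∃ S : Finset ℕ, ∀ T : Finset ℕ, Disjoint T S → ∑ k ∈ T, ‖y k‖ ^ p k ≤ ρ := by
  obtain ⟨S, hS⟩ := summable_iff_vanishing_norm.1 hy ρ hρ
  exact ⟨S, fun T hT => (le_abs_self _).trans (hS T hT).le⟩

lemma EquiSmall.summable_norm {c : ι → ℕ → 𝕜} (hc : EquiSmall p c) {y : ℕ → 𝕜}
    (hy : y ∈ maddoxL p) (i : ι) : Summable fun k => ‖c i k * y k‖ := by
  rw [summable_iff_vanishing_norm]
  intro ε hε
  obtain ⟨ρ, hρ, h⟩ := hc (ε / 2) (by positivity)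
  obtain ⟨S, hS⟩ := exists_finset_sum_le hy hρ
  refine ⟨S, fun T hT => ?_⟩
  rw [Real.norm_of_nonneg (Finset.sum_nonneg fun _ _ => norm_nonneg _)]
  linarith [h i T y (hS T hT)]

lemma norm_tsum_sub_sum_le {f : ℕ → 𝕜} (hf : Summable f) {S : Finset ℕ} {ε : ℝ}
    (h : ∀ T : Finset ℕ, Disjoint T S → ∑ k ∈ T, ‖f k‖ ≤ ε) : ‖∑' k, f k - ∑ k ∈ S, f k‖ ≤ ε := by
  have ht : Tendsto (fun T : Finset ℕ => ‖∑ k ∈ T, f k - ∑ k ∈ S, f k‖) atTop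
      (𝓝 ‖∑' k, f k - ∑ k ∈ S, f k‖) := (hf.hasSum.sub_const _).norm
  refine le_of_tendsto ht ?_
  filter_upwards [eventually_ge_atTop S] with T hT
  rw [← Finset.sum_sdiff hT, add_sub_cancel_right]
  exact (norm_sum_le _ _).trans (h _ Finset.sdiff_disjoint)

lemma EquiSmall.rowSmall_of_tendsto {c : ℕ → ℕ → 𝕜} (hc : EquiSmall p c) {α : ℕ → 𝕜}
    (hα : ∀ k, Tendsto (fun m => c m k) atTop (𝓝 (α k))) : RowSmall p α := by
  intro ε hε
  obtain ⟨ρ, hρ, h⟩ := hc ε hε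
  refine ⟨ρ, hρ, fun _ S y hy => ?_⟩
  refine le_of_tendsto (f := fun m => ∑ k ∈ S, ‖c m k * y k‖)
    (tendsto_finsetSum S fun k _ => ((hα k).mul_const (y k)).norm) ?_
  exact Eventually.of_forall fun m => h m S y hy

/-- Off a finite set the modular of `y` is so small that the tails are at most `ε / 4`, uniformly in
`m` and also for the limit row; on the finite set, columnwise convergence suffices. -/
lemma EquiSmall.tendsto_tsum {c : ℕ → ℕ → 𝕜} (hc : EquiSmall p c) {α : ℕ → 𝕜}
    (hα : ∀ k, Tendsto (fun m => c m k) atTop (𝓝 (α k))) {y : ℕ → 𝕜} (hy : y ∈ maddoxL p) :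
    Tendsto (fun m => ∑' k, c m k * y k) atTop (𝓝 (∑' k, α k * y k)) := by
  have hr := hc.rowSmall_of_tendsto hα
  rw [Metric.tendsto_atTop]
  intro ε hε
  obtain ⟨ρ₁, hρ₁, h₁⟩ := hc (ε / 4) (by positivity)
  obtain ⟨ρ₂, hρ₂, h₂⟩ := hr (ε / 4) (by positivity)
  obtain ⟨S, hS⟩ := exists_finset_sum_le hy (lt_min hρ₁ hρ₂)
  have hlim : Tendsto (fun m => ∑ k ∈ S, c m k * y k) atTop (𝓝 (∑ k ∈ S, α k * y k)) :=
    tendsto_finsetSum S fun k _ => (hα k).mul_const (y k)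
  obtain ⟨N, hN⟩ := Metric.tendsto_atTop.1 hlim (ε / 4) (by positivity)
  refine ⟨N, fun m hm => ?_⟩
  have e₁ := norm_tsum_sub_sum_le (hc.summable_norm hy m).of_norm
    fun T hT => h₁ m T y ((hS T hT).trans (min_le_left _ _))
  have e₂ := norm_tsum_sub_sum_le (hr.summable_norm hy ()).of_norm
    fun T hT => h₂ () T y ((hS T hT).trans (min_le_right _ _))
  have e₃ := hN m hm
  rw [dist_eq_norm] at e₃ ⊢
  have : ∑' k, c m k * y k - ∑' k, α k * y k =
      (∑' k, c m k * y k - ∑ k ∈ S, c m k * y k) + (∑ k ∈ S, c m k * y k - ∑ k ∈ S, α k * y k) -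
        (∑' k, α k * y k - ∑ k ∈ S, α k * y k) := by ring
  rw [this]
  refine (norm_sub_le _ _).trans_lt ?_
  have := norm_add_le (∑' k, c m k * y k - ∑ k ∈ S, c m k * y k)
    (∑ k ∈ S, c m k * y k - ∑ k ∈ S, α k * y k)
  linarith

lemma EquiSmall.exists_column_bound {c : ι → ℕ → 𝕜} (hc : EquiSmall p c) (hp : ∀ k, 0 < p k)
    (k : ℕ) : ∃ B, ∀ i, ‖c i k‖ ≤ B := by
  obtain ⟨ρ, hρ, h⟩ := hc 1 one_pos
  have hρ' : 0 < ρ ^ (p k)⁻¹ := Real.rpow_pos_of_pos hρ _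
  refine ⟨1 / ρ ^ (p k)⁻¹, fun i => ?_⟩
  have := h i {k} (fun _ => ((ρ ^ (p k)⁻¹ : ℝ) : 𝕜)) (by
    simp [abs_of_pos hρ', Real.rpow_inv_rpow hρ.le (hp k).ne'])
  rw [le_div_iff₀ hρ']
  simpa [abs_of_pos hρ'] using this

/-- The tail is bounded by equicontinuity and the finite head by the column bounds. -/
lemma EquiSmall.exists_bound {c : ι → ℕ → 𝕜} (hc : EquiSmall p c) (hp : ∀ k, 0 < p k)
    {y : ℕ → 𝕜} (hy : y ∈ maddoxL p) : ∃ B, ∀ i, ‖∑' k, c i k * y k‖ ≤ B := by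
  choose B hB using hc.exists_column_bound hp
  obtain ⟨ρ, hρ, h⟩ := hc 1 one_pos
  obtain ⟨S, hS⟩ := exists_finset_sum_le hy hρ
  refine ⟨1 + ∑ k ∈ S, B k * ‖y k‖, fun i => ?_⟩
  have e := norm_tsum_sub_sum_le (hc.summable_norm hy i).of_norm
    fun T hT => h i T y (hS T hT)
  have e' : ‖∑ k ∈ S, c i k * y k‖ ≤ ∑ k ∈ S, B k * ‖y k‖ := norm_sum_le_of_le _ fun k _ => by
    rw [norm_mul]
    exact mul_le_mul_of_nonneg_right (hB k i) (norm_nonneg _)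
  have := norm_le_norm_sub_add (∑' k, c i k * y k) (∑ k ∈ S, c i k * y k)
  linarith

lemma rowSmall_zero : RowSmall p (fun _ => (0 : 𝕜)) :=
  fun ε hε => ⟨1, one_pos, fun _ S y _ => by simpa using hε.le⟩

lemma RowSmall.add {c d : ℕ → 𝕜} (hc : RowSmall p c) (hd : RowSmall p d) :
    RowSmall p fun k => c k + d k := by
  intro ε hε
  obtain ⟨ρ₁, hρ₁, h₁⟩ := hc (ε / 2) (by positivity)
  obtain ⟨ρ₂, hρ₂, h₂⟩ := hd (ε / 2) (by positivity)
  refine ⟨min ρ₁ ρ₂, lt_min hρ₁ hρ₂, fun _ S y hy => ?_⟩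
  have e₁ := h₁ () S y (hy.trans (min_le_left _ _))
  have e₂ := h₂ () S y (hy.trans (min_le_right _ _))
  calc ∑ k ∈ S, ‖(c k + d k) * y k‖ ≤ ∑ k ∈ S, (‖c k * y k‖ + ‖d k * y k‖) :=
        Finset.sum_le_sum fun k _ => by rw [add_mul]; exact norm_add_le _ _
    _ ≤ ε := by rw [Finset.sum_add_distrib]; linarith

lemma RowSmall.sum {κ : Type*} {e : κ → ℕ → 𝕜} (he : ∀ n, RowSmall p (e n)) (F : Finset κ) :
    RowSmall p fun k => ∑ n ∈ F, e n k := by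
  classical
  induction F using Finset.induction_on with
  | empty => simpa using rowSmall_zero
  | insert n F hn ih =>
    simp only [Finset.sum_insert hn]
    exact (he n).add ih

lemma rowSmall_single (hp : ∀ k, 0 < p k) (j : ℕ) (v : 𝕜) :
    RowSmall p fun k => if k = j then v else 0 := by
  intro ε hε
  have hq : 0 < ε / (‖v‖ + 1) := by positivity
  refine ⟨(ε / (‖v‖ + 1)) ^ p j, Real.rpow_pos_of_pos hq _, fun _ S y hy => ?_⟩
  by_cases hj : j ∈ S
  · have h1 : ‖y j‖ ^ p j ≤ (ε / (‖v‖ + 1)) ^ p j :=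
      (Finset.single_le_sum (f := fun k => ‖y k‖ ^ p k)
        (fun k _ => Real.rpow_nonneg (norm_nonneg _) _) hj).trans hy
    have h2 : ‖y j‖ ≤ ε / (‖v‖ + 1) :=
      (Real.rpow_le_rpow_iff (norm_nonneg _) hq.le (hp j)).1 h1
    rw [Finset.sum_eq_single_of_mem j hj (fun k _ hk => by simp [hk])]
    rw [le_div_iff₀ (by positivity)] at h2
    simp only [if_true, norm_mul]
    nlinarith [norm_nonneg (y j)]
  · rw [Finset.sum_eq_zero]
    · exact hε.le
    · intro k hk
      have : k ≠ j := fun h => hj (h ▸ hk)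
      simp [this]

lemma rowSmall_of_eventually_zero (hp : ∀ k, 0 < p k) {c : ℕ → 𝕜} {m : ℕ}
    (hc : ∀ k, m < k → c k = 0) : RowSmall p c := by
  have : c = fun k => ∑ j ∈ Finset.range (m + 1), if k = j then c j else 0 := by
    ext k
    rw [Finset.sum_ite_eq]
    split_ifs with h
    · rfl
    · exact hc k (by simpa using h)
  rw [this]
  exact RowSmall.sum (e := fun j k => if k = j then c j else 0)
    (fun j => rowSmall_single hp j (c j)) _

end Equicontinuity

/-! ### Uniform boundedness on `l(p)`. -/

section GlidingHump

variable {𝕜 : Type*} [RCLike 𝕜] {ι : Type*} {p : ℕ → ℝ}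

/-- One step of the gliding hump: the vector built so far is kept below `K` and a cheap block is
added on `[K, K')` that makes some functional exceed `N`. The new budget `δ'` is so small that
whatever is added later changes this functional by at most 1. -/
lemma exists_hump (hp : ∀ k, 0 < p k) {c : ι → ℕ → 𝕜} (hrow : ∀ i, RowSmall p (c i))
    {B : ℕ → ℝ} (hB : ∀ k i, ‖c i k‖ ≤ B k) (hc : ¬ BddNearZero p c)
    (N : ℕ) (K : ℕ) (x : ℕ → 𝕜) (δ : ℝ) (hδ : 0 < δ) :
    ∃ (i : ι) (K' : ℕ) (x' : ℕ → 𝕜) (δ' : ℝ), 0 < δ' ∧ K < K' ∧ (∀ k < K, x' k = x k) ∧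
      δ' ≤ δ / 2 ∧ ∑ k ∈ Finset.Ico K K', ‖x' k‖ ^ p k ≤ δ / 2 ∧
      (N : ℝ) ≤ ‖∑ k ∈ Finset.range K', c i k * x' k‖ ∧
      ∀ (S : Finset ℕ) (y : ℕ → 𝕜), ∑ k ∈ S, ‖y k‖ ^ p k ≤ δ' → ∑ k ∈ S, ‖c i k * y k‖ ≤ 1 := by
  simp only [BddNearZero, not_exists, not_and, not_forall, not_le] at hc
  -- The two sums added to `N` pay for the old head `x` and for the part of `y` below `K` that is
  -- discarded. Radius at most 1 forces `‖y k‖ ≤ 1`, so the latter costs at most `∑ B k`.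
  obtain ⟨i, S, y, hy, hbig⟩ := hc (min (δ / 2) 1) (by positivity)
    (N + ∑ k ∈ Finset.range K, B k * ‖x k‖ + ∑ k ∈ Finset.range K, B k)
  obtain ⟨ρ, hρ, hsm⟩ := hrow i 1 one_pos
  have hterm : ∀ k ∈ S, ‖y k‖ ^ p k ≤ 1 := fun k hk =>
    (Finset.single_le_sum (f := fun k => ‖y k‖ ^ p k)
      (fun k _ => Real.rpow_nonneg (norm_nonneg _) _) hk).trans (hy.trans (min_le_right _ _))
  have hy1 : ∀ k ∈ S, ‖y k‖ ≤ 1 := fun k hk => by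
    by_contra h
    exact (hterm k hk).not_gt (Real.one_lt_rpow (not_le.1 h) (hp k))
  set K' := max (K + 1) (S.sup id + 1) with hK'
  have hSK : ∀ k ∈ S, k < K' := fun k hk =>
    lt_of_lt_of_le (Nat.lt_succ_of_le (Finset.le_sup (f := id) hk)) (le_max_right _ _)
  set x' : ℕ → 𝕜 := fun k => if k < K then x k else if k ∈ S then y k else 0 with hx'
  have hKK : K < K' := lt_of_lt_of_le (Nat.lt_succ_self K) (le_max_left _ _)
  have hfilter : Finset.filter (· ∈ S) (Finset.Ico K K') = Finset.filter (fun k => ¬ k < K) S := by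
    ext k
    simp only [Finset.mem_filter, Finset.mem_Ico, not_lt]
    exact ⟨fun h => ⟨h.2, h.1.1⟩, fun h => ⟨⟨h.2, hSK k h.1⟩, h.1⟩⟩
  refine ⟨i, K', x', min ρ (δ / 2), by positivity, hKK, fun k hk => by simp [hx', hk],
    min_le_right _ _, ?_, ?_, fun T z hz => hsm () T z (hz.trans (min_le_left _ _))⟩
  · have e : ∑ k ∈ Finset.Ico K K', ‖x' k‖ ^ p k =
        ∑ k ∈ Finset.filter (fun k => ¬ k < K) S, ‖y k‖ ^ p k := by
      rw [← hfilter, Finset.sum_filter]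
      refine Finset.sum_congr rfl fun k hk => ?_
      have : ¬ k < K := not_lt.2 (Finset.mem_Ico.1 hk).1
      by_cases hkS : k ∈ S <;> simp [hx', this, hkS, Real.zero_rpow (hp k).ne']
    rw [e]
    exact (Finset.sum_le_sum_of_subset_of_nonneg (Finset.filter_subset _ _)
      fun k _ _ => Real.rpow_nonneg (norm_nonneg _) _).trans (hy.trans (min_le_left _ _))
  · have e₁ : ∑ k ∈ Finset.range K', c i k * x' k =
        ∑ k ∈ Finset.range K, c i k * x k +
          ∑ k ∈ Finset.filter (fun k => ¬ k < K) S, c i k * y k := by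
      rw [← Finset.sum_range_add_sum_Ico _ hKK.le, ← hfilter, Finset.sum_filter]
      congr 1
      · exact Finset.sum_congr rfl fun k hk => by simp [hx', Finset.mem_range.1 hk]
      · refine Finset.sum_congr rfl fun k hk => ?_
        have : ¬ k < K := not_lt.2 (Finset.mem_Ico.1 hk).1
        by_cases hkS : k ∈ S <;> simp [hx', this, hkS]
    have e₂ : ‖∑ k ∈ Finset.range K, c i k * x k‖ ≤ ∑ k ∈ Finset.range K, B k * ‖x k‖ :=
      norm_sum_le_of_le _ fun k _ => by
        rw [norm_mul]
        exact mul_le_mul_of_nonneg_right (hB k i) (norm_nonneg _)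
    have e₃ : ‖∑ k ∈ Finset.filter (fun k => k < K) S, c i k * y k‖ ≤
        ∑ k ∈ Finset.range K, B k := by
      refine (norm_sum_le_of_le (f := fun k => c i k * y k) (n := B) _ fun k hk => ?_).trans
        (Finset.sum_le_sum_of_subset_of_nonneg ?_ fun k _ _ => (norm_nonneg _).trans (hB k i))
      · rw [norm_mul]
        exact (mul_le_of_le_one_right (norm_nonneg _)
          (hy1 k (Finset.mem_filter.1 hk).1)).trans (hB k i)
      · intro k hk
        simpa using (Finset.mem_filter.1 hk).2
    have e₄ := Finset.sum_filter_add_sum_filter_not S (fun k => k < K) fun k => c i k * y k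
    rw [e₁]
    rw [← e₄] at hbig
    have e₅ := norm_add_le (∑ k ∈ Finset.filter (fun k => k < K) S, c i k * y k)
      (∑ k ∈ Finset.filter (fun k => ¬ k < K) S, c i k * y k)
    have e₆ := norm_sub_le (∑ k ∈ Finset.range K, c i k * x k +
      ∑ k ∈ Finset.filter (fun k => ¬ k < K) S, c i k * y k) (∑ k ∈ Finset.range K, c i k * x k)
    rw [add_sub_cancel_left] at e₆
    linarith

/-- Uniform boundedness principle for the Maddox space `l(p)`, by a gliding hump. -/
theorem bddNearZero_of_pointwise_bounded (hp : ∀ k, 0 < p k) {c : ι → ℕ → 𝕜}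
    (hrow : ∀ i, RowSmall p (c i))
    (hb : ∀ y ∈ maddoxL p, ∃ B, ∀ i, ‖∑' k, c i k * y k‖ ≤ B) : BddNearZero p c := by
  by_contra hc
  have hcol : ∀ k, ∃ B, ∀ i, ‖c i k‖ ≤ B := fun k => by
    obtain ⟨B, hB⟩ := hb (fun j => if j = k then 1 else 0) (by
      refine summable_of_ne_finset_zero (s := {k}) fun j hj => ?_
      have : j ≠ k := by simpa using hj
      simp [this, Real.zero_rpow (hp j).ne'])
    exact ⟨B, fun i => by simpa using hB i⟩
  choose B hB using hcol
  have hstep : ∀ (N : ℕ) (a : ℕ × (ℕ → 𝕜) × {δ : ℝ // 0 < δ}),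
      ∃ (i : ι) (b : ℕ × (ℕ → 𝕜) × {δ : ℝ // 0 < δ}), a.1 < b.1 ∧
        (∀ k < a.1, b.2.1 k = a.2.1 k) ∧ (b.2.2 : ℝ) ≤ a.2.2 / 2 ∧
        ∑ k ∈ Finset.Ico a.1 b.1, ‖b.2.1 k‖ ^ p k ≤ a.2.2 / 2 ∧
        (N : ℝ) ≤ ‖∑ k ∈ Finset.range b.1, c i k * b.2.1 k‖ ∧
        ∀ (S : Finset ℕ) (y : ℕ → 𝕜), ∑ k ∈ S, ‖y k‖ ^ p k ≤ b.2.2 →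
          ∑ k ∈ S, ‖c i k * y k‖ ≤ 1 := by
    intro N a
    obtain ⟨i, K', x', δ', hδ', h⟩ := exists_hump hp hrow hB hc N a.1 a.2.1 a.2.2 a.2.2.2
    exact ⟨i, (K', x', ⟨δ', hδ'⟩), h⟩
  choose I nxt hK hx hδ hsum hbig hsmall using hstep
  let st : ℕ → ℕ × (ℕ → 𝕜) × {δ : ℝ // 0 < δ} := fun n =>
    Nat.rec (0, 0, ⟨1, one_pos⟩) (fun n a => nxt n a) n
  have hst : ∀ n, st (n + 1) = nxt n (st n) := fun n => rfl
  have hmono : StrictMono fun n => (st n).1 := strictMono_nat_of_lt_succ fun n => by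
    rw [hst]; exact hK n (st n)
  have hagree : ∀ n m, n ≤ m → ∀ k < (st n).1, (st m).2.1 k = (st n).2.1 k := by
    intro n m hnm
    induction m, hnm using Nat.le_induction with
    | base => intro k _; rfl
    | succ m hm ih =>
      intro k hk
      rw [hst, hx m (st m) k (hk.trans_le (hmono.monotone hm)), ih k hk]
  -- Coordinate `k` is final by stage `k + 1`, because the cut-offs increase strictly and hence `k +
  -- 1 ≤ (st (k + 1)).1`.
  let y : ℕ → 𝕜 := fun k => (st (k + 1)).2.1 k
  have hy : ∀ n, ∀ k < (st n).1, y k = (st n).2.1 k := by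
    intro n k hk
    rcases le_total n (k + 1) with h | h
    · exact hagree n (k + 1) h k hk
    · exact (hagree (k + 1) n h k (Nat.lt_of_succ_le (hmono.id_le (k + 1)))).symm
  -- Telescoping: block `m` costs at most half the current budget and the next budget is at most the
  -- other half.
  have hIco : ∀ n m, n ≤ m → ∑ k ∈ Finset.Ico (st n).1 (st m).1, ‖y k‖ ^ p k ≤
      (st n).2.2 - (st m).2.2 := by
    intro n m hnm
    induction m, hnm using Nat.le_induction with
    | base => simp
    | succ m hm ih =>
      rw [← Finset.sum_Ico_consecutive _ (hmono.monotone hm) (hmono.monotone (Nat.le_succ m))]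
      have e : ∑ k ∈ Finset.Ico (st m).1 (st (m + 1)).1, ‖y k‖ ^ p k =
          ∑ k ∈ Finset.Ico (st m).1 (st (m + 1)).1, ‖(st (m + 1)).2.1 k‖ ^ p k :=
        Finset.sum_congr rfl fun k hk => by rw [hy (m + 1) k (Finset.mem_Ico.1 hk).2]
      have e₁ := hsum m (st m)
      have e₂ := hδ m (st m)
      rw [← hst] at e₁ e₂
      linarith
  have htail : ∀ n (T : Finset ℕ), Disjoint T (Finset.range (st n).1) →
      ∑ k ∈ T, ‖y k‖ ^ p k ≤ (st n).2.2 := by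
    intro n T hT
    set M := max n (T.sup id + 1)
    have hsub : T ⊆ Finset.Ico (st n).1 (st M).1 := fun k hk => by
      rw [Finset.mem_Ico]
      refine ⟨by simpa using Finset.disjoint_left.1 hT hk, ?_⟩
      have h1 : k < M := lt_of_lt_of_le (Nat.lt_succ_of_le (Finset.le_sup (f := id) hk))
        (le_max_right _ _)
      exact h1.trans_le (hmono.id_le M)
    have := (Finset.sum_le_sum_of_subset_of_nonneg hsub
      fun k _ _ => Real.rpow_nonneg (norm_nonneg (y k)) (p k)).trans (hIco n M (le_max_left _ _))
    linarith [(st M).2.2.2]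
  have hyl : y ∈ maddoxL p :=
    summable_of_sum_le (fun k => Real.rpow_nonneg (norm_nonneg _) _)
      fun T => htail 0 T (by simp [st])
  obtain ⟨C, hC⟩ := hb y hyl
  -- The extra 1 absorbs the tail of `y` beyond the hump of stage `n`.
  obtain ⟨n, hn⟩ := exists_nat_gt (C + 1)
  have e₁ := hbig n (st n)
  have e₂ := norm_tsum_sub_sum_le (((hrow (I n (st n))).summable_norm hyl ()).of_norm)
    fun T hT => hsmall n (st n) T y (by rw [← hst]; exact htail (n + 1) T hT)
  rw [← hst] at e₁
  have e₃ : ∑ k ∈ Finset.range (st (n + 1)).1, c (I n (st n)) k * (st (n + 1)).2.1 k =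
      ∑ k ∈ Finset.range (st (n + 1)).1, c (I n (st n)) k * y k :=
    Finset.sum_congr rfl fun k hk => by rw [hy (n + 1) k (Finset.mem_range.1 hk)]
  rw [e₃] at e₁
  have e₄ := norm_sub_le (∑' k, c (I n (st n)) k * y k) (∑' k, c (I n (st n)) k * y k -
    ∑ k ∈ Finset.range (st (n + 1)).1, c (I n (st n)) k * y k)
  rw [sub_sub_cancel] at e₄
  linarith [hC (I n (st n))]

end GlidingHump

/-! ### Coefficient criteria for boundedness and equicontinuity. -/

section Conditions

variable {𝕜 : Type*} [RCLike 𝕜] {ι : Type*} {p : ℕ → ℝ}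

lemma iSup_tsum_ofReal_lt_top_iff {g : ι → ℕ → ℝ} (hg : ∀ i k, 0 ≤ g i k) :
    (⨆ i, ∑' k, ENNReal.ofReal (g i k)) < ⊤ ↔ ∃ M, ∀ i (S : Finset ℕ), ∑ k ∈ S, g i k ≤ M := by
  constructor
  · intro h
    refine ⟨(⨆ i, ∑' k, ENNReal.ofReal (g i k)).toReal, fun i S => ?_⟩
    rw [← ENNReal.ofReal_le_iff_le_toReal h.ne, ENNReal.ofReal_sum_of_nonneg fun k _ => hg i k]
    exact (ENNReal.sum_le_tsum S).trans (le_iSup (fun i => ∑' k, ENNReal.ofReal (g i k)) i)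
  · rintro ⟨M, hM⟩
    refine lt_of_le_of_lt (iSup_le fun i => ?_) (ENNReal.ofReal_lt_top (r := M))
    rw [ENNReal.tsum_eq_iSup_sum]
    refine iSup_le fun S => ?_
    rw [← ENNReal.ofReal_sum_of_nonneg fun k _ => hg i k]
    exact ENNReal.ofReal_le_ofReal (hM i S)

lemma iSup_ofReal_lt_top_iff {g : ι → ℝ} :
    (⨆ i, ENNReal.ofReal (g i)) < ⊤ ↔ ∃ M, ∀ i, g i ≤ M := by
  constructor
  · intro h
    refine ⟨(⨆ i, ENNReal.ofReal (g i)).toReal, fun i => ?_⟩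
    rw [← ENNReal.ofReal_le_iff_le_toReal h.ne]
    exact le_iSup (fun i => ENNReal.ofReal (g i)) i
  · rintro ⟨M, hM⟩
    exact lt_of_le_of_lt (iSup_le fun i => ENNReal.ofReal_le_ofReal (hM i))
      (ENNReal.ofReal_lt_top (r := M))

lemma iSup_iSup_ofReal_lt_top_iff {g : ι → ℕ → ℝ} :
    (⨆ i, ⨆ k, ENNReal.ofReal (g i k)) < ⊤ ↔ ∃ M, ∀ i k, g i k ≤ M := by
  rw [← iSup_prod (f := fun q : ι × ℕ => ENNReal.ofReal (g q.1 q.2)), iSup_ofReal_lt_top_iff]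
  simp [Prod.forall]

/-- The condition describing bounded families of functionals on `l(p)` when all `p k > 1`. -/
def ConjBounded (p : ℕ → ℝ) (c : ι → ℕ → 𝕜) : Prop :=
  ∃ L : ℕ, 0 < L ∧
    (⨆ i, ∑' k, ENNReal.ofReal (‖c i k * (L : 𝕜)⁻¹‖ ^ conjExp (p k))) < ⊤

/-- The condition describing bounded families of functionals on `l(p)` when all `p k ≤ 1`. -/
def PowBounded (p : ℕ → ℝ) (c : ι → ℕ → 𝕜) : Prop :=
  (⨆ i, ⨆ k, ENNReal.ofReal (‖c i k‖ ^ p k)) < ⊤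

lemma conjBounded_iff {c : ι → ℕ → 𝕜} : ConjBounded p c ↔ ∃ L : ℕ, 0 < L ∧
    ∃ M, ∀ i (S : Finset ℕ), ∑ k ∈ S, ‖c i k * (L : 𝕜)⁻¹‖ ^ conjExp (p k) ≤ M :=
  exists_congr fun _ => and_congr_right fun _ =>
    iSup_tsum_ofReal_lt_top_iff fun _ _ => Real.rpow_nonneg (norm_nonneg _) _

lemma powBounded_iff {c : ι → ℕ → 𝕜} : PowBounded p c ↔ ∃ M, ∀ i k, ‖c i k‖ ^ p k ≤ M :=
  iSup_iSup_ofReal_lt_top_iff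

lemma holderConjugate_conjExp {q : ℝ} (hq : 1 < q) : q.HolderConjugate (conjExp q) :=
  Real.HolderConjugate.conjExponent hq

/-- Hölder's extremal vector is the test vector. If a sum `σ` exceeded `ρ`, scaling by `ρ / σ ≤ 1`
would bring its modular down to at most `ρ`, while the functional would take the value `ρ * L > C`.
-/
lemma BddNearZero.conjBounded {c : ι → ℕ → 𝕜} (hp1 : ∀ k, 1 < p k) (h : BddNearZero p c) :
    ConjBounded p c := by
  obtain ⟨ρ, hρ, C, hC⟩ := h
  obtain ⟨L, hL⟩ := exists_nat_gt (max (C / ρ) 0)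
  have hL0 : (0 : ℝ) < L := (le_max_right _ _).trans_lt hL
  refine conjBounded_iff.2 ⟨L, by exact_mod_cast hL0, ρ, fun i S => ?_⟩
  by_contra! hS
  set σ := ∑ k ∈ S, ‖c i k * (L : 𝕜)⁻¹‖ ^ conjExp (p k) with hσ
  have hσ0 : 0 < σ := hρ.trans hS
  set lam := ρ / σ with hlam
  have hlam0 : 0 < lam := by positivity
  have hlam1 : lam ≤ 1 := (div_le_one hσ0).2 hS.le
  -- The conjugate phase makes every product `c i k * y k` real and nonnegative; where `c i k = 0`
  -- the phase is `0 / 0 = 0`.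
  set y : ℕ → 𝕜 := fun k => ((lam * ‖c i k * (L : 𝕜)⁻¹‖ ^ (conjExp (p k) - 1) : ℝ) : 𝕜) *
    (starRingEnd 𝕜 (c i k) / (‖c i k‖ : 𝕜)) with hy
  have hnorm : ∀ k, ‖y k‖ ≤ lam * ‖c i k * (L : 𝕜)⁻¹‖ ^ (conjExp (p k) - 1) := fun k => by
    have h0 : 0 ≤ lam * ‖c i k * (L : 𝕜)⁻¹‖ ^ (conjExp (p k) - 1) := by positivity
    rw [hy]
    simp only [norm_mul (RCLike.ofReal _ : 𝕜), RCLike.norm_ofReal, abs_of_nonneg h0]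
    refine mul_le_of_le_one_right h0 ?_
    rw [norm_div, RCLike.norm_conj, RCLike.norm_ofReal, abs_norm]
    exact div_self_le_one _
  have hpow : ∀ k, ‖y k‖ ^ p k ≤ lam * ‖c i k * (L : 𝕜)⁻¹‖ ^ conjExp (p k) := fun k => by
    have hpk : 0 < p k := one_pos.trans (hp1 k)
    have hm : (conjExp (p k) - 1) * p k = conjExp (p k) := by
      have : p k - 1 ≠ 0 := by linarith [hp1 k]
      rw [conjExp]
      field_simp
      ring
    refine (Real.rpow_le_rpow (norm_nonneg _) (hnorm k) hpk.le).trans ?_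
    rw [Real.mul_rpow hlam0.le (Real.rpow_nonneg (norm_nonneg _) _),
      ← Real.rpow_mul (norm_nonneg _), hm]
    refine mul_le_mul_of_nonneg_right ?_ (Real.rpow_nonneg (norm_nonneg _) _)
    simpa using Real.rpow_le_rpow_of_exponent_ge hlam0 hlam1 (hp1 k).le
  have hmul : ∀ k, c i k * y k =
      ((lam * L * ‖c i k * (L : 𝕜)⁻¹‖ ^ conjExp (p k) : ℝ) : 𝕜) := fun k => by
    have hq : 0 < conjExp (p k) := (holderConjugate_conjExp (hp1 k)).symm.pos
    by_cases h0 : c i k = 0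
    · simp [h0, Real.zero_rpow hq.ne']
    · have hn : 0 < ‖c i k‖ := norm_pos_iff.2 h0
      have hn' : (‖c i k‖ : 𝕜) ≠ 0 := by exact_mod_cast hn.ne'
      have hcL : ‖c i k * (L : 𝕜)⁻¹‖ = ‖c i k‖ / L := by
        rw [norm_mul, norm_inv, RCLike.norm_natCast, div_eq_mul_inv]
      have hpos : 0 < ‖c i k‖ / L := by positivity
      have e : c i k * (starRingEnd 𝕜 (c i k) / (‖c i k‖ : 𝕜)) = (‖c i k‖ : 𝕜) := by
        rw [← mul_div_assoc, RCLike.mul_conj, sq, mul_div_assoc, div_self hn', mul_one]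
      rw [hy]
      simp only
      rw [mul_left_comm, e, ← RCLike.ofReal_mul, hcL, Real.rpow_sub_one hpos.ne']
      congr 1
      field_simp
  have h1 : ∑ k ∈ S, ‖y k‖ ^ p k ≤ ρ := by
    refine (Finset.sum_le_sum fun k _ => hpow k).trans ?_
    rw [← Finset.mul_sum, ← hσ, hlam, div_mul_cancel₀ _ hσ0.ne']
  have h2 := hC i S y h1
  rw [Finset.sum_congr rfl fun k _ => hmul k, ← RCLike.ofReal_sum, ← Finset.mul_sum, ← hσ,
    RCLike.norm_ofReal, abs_of_nonneg (by positivity)] at h2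
  have h3 : lam * L * σ = ρ * L := by
    rw [hlam]
    field_simp
  rw [h3] at h2
  have h4 : C / ρ < L := (le_max_left _ _).trans_lt hL
  rw [div_lt_iff₀ hρ] at h4
  linarith

/-- Weighted Young inequality: `δ` makes the conjugate-power part at most `ε / 2`, and the modular
of `y` controls the rest. Boundedness of `p` keeps the weight `δ⁻¹ ^ p k` below `δ⁻¹ ^ H`. -/
lemma ConjBounded.equiSmall {c : ι → ℕ → 𝕜} (hp1 : ∀ k, 1 < p k) (hpb : BddAbove (Set.range p))
    (h : ConjBounded p c) : EquiSmall p c := by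
  obtain ⟨L, hL, M, hM⟩ := conjBounded_iff.1 h
  obtain ⟨H, hH⟩ := hpb
  have hH : ∀ k, p k ≤ H := fun k => hH ⟨k, rfl⟩
  have hL0 : (0 : ℝ) < L := by exact_mod_cast hL
  intro ε hε
  set M' := max M 1 with hM'
  have hM0 : 0 < M' := one_pos.trans_le (le_max_right _ _)
  set δ := min 1 (ε / (2 * L * M')) with hδ
  have hδ0 : 0 < δ := by positivity
  have hδ1 : δ ≤ 1 := min_le_left _ _
  have hD : 0 < δ⁻¹ ^ H := Real.rpow_pos_of_pos (inv_pos.2 hδ0) _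
  refine ⟨ε / (2 * L * δ⁻¹ ^ H), by positivity, fun i S y hy => ?_⟩
  have hterm : ∀ k, ‖c i k * y k‖ ≤
      L * (δ * ‖c i k * (L : 𝕜)⁻¹‖ ^ conjExp (p k) + δ⁻¹ ^ H * ‖y k‖ ^ p k) := fun k => by
    have hconj := (holderConjugate_conjExp (hp1 k)).symm
    have hq1 : 1 ≤ conjExp (p k) := hconj.lt.le
    set u := ‖c i k * (L : 𝕜)⁻¹‖ with hu
    have hu0 : 0 ≤ u := norm_nonneg _
    have hcu : ‖c i k‖ = L * u := by
      rw [hu, norm_mul, norm_inv, RCLike.norm_natCast]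
      field_simp
    have hyoung := Real.young_inequality_of_nonneg (a := δ * u) (b := δ⁻¹ * ‖y k‖)
      (by positivity) (by positivity) hconj
    have e₁ : (δ * u) ^ conjExp (p k) / conjExp (p k) ≤ δ * u ^ conjExp (p k) := by
      refine (div_le_self (by positivity) hq1).trans ?_
      rw [Real.mul_rpow hδ0.le hu0]
      refine mul_le_mul_of_nonneg_right ?_ (Real.rpow_nonneg hu0 _)
      simpa using Real.rpow_le_rpow_of_exponent_ge hδ0 hδ1 hq1
    have e₂ : (δ⁻¹ * ‖y k‖) ^ p k / p k ≤ δ⁻¹ ^ H * ‖y k‖ ^ p k := by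
      refine (div_le_self (by positivity) (hp1 k).le).trans ?_
      rw [Real.mul_rpow (inv_pos.2 hδ0).le (norm_nonneg _)]
      refine mul_le_mul_of_nonneg_right ?_ (Real.rpow_nonneg (norm_nonneg _) _)
      exact Real.rpow_le_rpow_of_exponent_le ((one_le_inv₀ hδ0).2 hδ1) (hH k)
    have e₃ : δ * u * (δ⁻¹ * ‖y k‖) = u * ‖y k‖ := by field_simp
    rw [norm_mul, hcu, mul_assoc]
    refine mul_le_mul_of_nonneg_left ?_ hL0.le
    linarith
  calc ∑ k ∈ S, ‖c i k * y k‖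
      ≤ ∑ k ∈ S, L * (δ * ‖c i k * (L : 𝕜)⁻¹‖ ^ conjExp (p k) + δ⁻¹ ^ H * ‖y k‖ ^ p k) :=
        Finset.sum_le_sum fun k _ => hterm k
    _ = L * (δ * ∑ k ∈ S, ‖c i k * (L : 𝕜)⁻¹‖ ^ conjExp (p k) +
          δ⁻¹ ^ H * ∑ k ∈ S, ‖y k‖ ^ p k) := by
        rw [← Finset.mul_sum, Finset.sum_add_distrib, Finset.mul_sum, Finset.mul_sum]
    _ ≤ L * (ε / (2 * L * M') * M' + δ⁻¹ ^ H * (ε / (2 * L * δ⁻¹ ^ H))) := by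
        gcongr
        · exact min_le_right _ _
        · exact (hM i S).trans (le_max_left _ _)
    _ = ε := by
        field_simp
        ring

lemma BddNearZero.powBounded {c : ι → ℕ → 𝕜} (hp : ∀ k, 0 < p k) (hp1 : ∀ k, p k ≤ 1)
    (h : BddNearZero p c) : PowBounded p c := by
  obtain ⟨ρ, hρ, C, hC⟩ := h
  refine powBounded_iff.2 ⟨max C 1 / ρ, fun i k => ?_⟩
  have hρ' : 0 < ρ ^ (p k)⁻¹ := Real.rpow_pos_of_pos hρ _
  have h1 := hC i {k} (fun _ => ((ρ ^ (p k)⁻¹ : ℝ) : 𝕜)) (by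
    simp [abs_of_pos hρ', Real.rpow_inv_rpow hρ.le (hp k).ne'])
  have h2 : ‖c i k‖ * ρ ^ (p k)⁻¹ ≤ max C 1 := by
    refine le_trans ?_ (le_max_left _ _)
    simpa [abs_of_pos hρ'] using h1
  have h3 := Real.rpow_le_rpow (by positivity) h2 (hp k).le
  rw [Real.mul_rpow (norm_nonneg _) hρ'.le, Real.rpow_inv_rpow hρ.le (hp k).ne'] at h3
  rw [le_div_iff₀ hρ]
  refine h3.trans ?_
  simpa using Real.rpow_le_rpow_of_exponent_le (le_max_right C 1) (hp1 k)

lemma PowBounded.equiSmall {c : ι → ℕ → 𝕜} (hp : ∀ k, 0 < p k) (hp1 : ∀ k, p k ≤ 1)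
    (h : PowBounded p c) : EquiSmall p c := by
  obtain ⟨M, hM⟩ := powBounded_iff.1 h
  intro ε hε
  set M' := max M 1 with hM'
  have hM0 : 0 < M' := one_pos.trans_le (le_max_right _ _)
  -- The bound `1 / M'` forces `‖c i k * y k‖ ≤ 1`, and then raising to a power `p k ≤ 1` does not
  -- decrease it; `ε / M'` gives the final estimate.
  refine ⟨min (1 / M') (ε / M'), by positivity, fun i S y hy => ?_⟩
  have hterm : ∀ k ∈ S, ‖c i k * y k‖ ≤ M' * ‖y k‖ ^ p k := fun k hk => by
    have h1 : ‖y k‖ ^ p k ≤ 1 / M' := (Finset.single_le_sum (f := fun k => ‖y k‖ ^ p k)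
      (fun k _ => Real.rpow_nonneg (norm_nonneg _) _) hk).trans (hy.trans (min_le_left _ _))
    have h2 : ‖c i k * y k‖ ^ p k ≤ M' * ‖y k‖ ^ p k := by
      rw [norm_mul, Real.mul_rpow (norm_nonneg _) (norm_nonneg _)]
      exact mul_le_mul_of_nonneg_right ((hM i k).trans (le_max_left _ _))
        (Real.rpow_nonneg (norm_nonneg _) _)
    have h3 : M' * ‖y k‖ ^ p k ≤ 1 := by
      rw [le_div_iff₀ hM0] at h1
      linarith
    refine le_trans ?_ h2
    have h4 : ‖c i k * y k‖ ≤ 1 := by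
      by_contra h
      exact (h2.trans h3).not_gt (Real.one_lt_rpow (not_le.1 h) (hp k))
    rcases (norm_nonneg (c i k * y k)).eq_or_lt with h0 | h0
    · rw [← h0]
      exact Real.rpow_nonneg le_rfl _
    · simpa using Real.rpow_le_rpow_of_exponent_ge h0 h4 (hp1 k)
  calc ∑ k ∈ S, ‖c i k * y k‖ ≤ ∑ k ∈ S, M' * ‖y k‖ ^ p k := Finset.sum_le_sum hterm
    _ ≤ M' * (ε / M') := by
        rw [← Finset.mul_sum]
        exact mul_le_mul_of_nonneg_left (hy.trans (min_le_right _ _)) hM0.le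
    _ = ε := mul_div_cancel₀ _ hM0.ne'

lemma norm_rpow_le_of_norm_le {B q H : ℝ} (hq : 0 < q) (hqH : q ≤ H) {v : 𝕜} (hv : ‖v‖ ≤ B) :
    ‖v‖ ^ q ≤ max B 1 ^ H :=
  (Real.rpow_le_rpow (norm_nonneg _) (hv.trans (le_max_left _ _)) hq.le).trans
    (Real.rpow_le_rpow_of_exponent_le (le_max_right _ _) hqH)

/-- Up to the factor `s 0`, the quantity in B3 is the diagonal entry of `E`. B4 bounds it uniformly,
since a number above 1 is at most its conjugate power. -/
lemma setB4_subset_setB3 (r s t : ℕ → 𝕜) (hs : s 0 ≠ 0) (hp1 : ∀ k, 1 < p k)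
    (hpb : BddAbove (Set.range p)) : setB4 r s t p ⊆ setB3 r t p := by
  intro a ha
  obtain ⟨L, hL, M, hM⟩ := conjBounded_iff.1 (show ConjBounded p (E r s t a) from ha)
  obtain ⟨H, hH⟩ := hpb
  have hL0 : (0 : ℝ) < L := by exact_mod_cast hL
  refine iSup_ofReal_lt_top_iff.2 ⟨max (‖s 0‖ * (max M 1 * L)) 1 ^ H, fun k => ?_⟩
  refine norm_rpow_le_of_norm_le (one_pos.trans (hp1 k)) (hH ⟨k, rfl⟩) ?_
  have h1 := hM k {k}
  rw [Finset.sum_singleton] at h1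
  have h2 : ‖E r s t a k k * (L : 𝕜)⁻¹‖ ≤ max M 1 := by
    by_contra! h
    have h3 : 1 ≤ ‖E r s t a k k * (L : 𝕜)⁻¹‖ := (le_max_right _ _).trans h.le
    have h4 := Real.rpow_le_rpow_of_exponent_le h3 (holderConjugate_conjExp (hp1 k)).symm.lt.le
    rw [Real.rpow_one] at h4
    linarith [le_max_left M 1]
  have h3 : r k * a k / t k = s 0 * E r s t a k k := by
    rw [E_self, mul_inv_cancel_left₀ hs]
  simp only [h3, norm_mul]
  refine mul_le_mul_of_nonneg_left ?_ (norm_nonneg _)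
  rw [norm_mul, norm_inv, RCLike.norm_natCast, ← div_eq_mul_inv, div_le_iff₀ hL0] at h2
  exact h2

lemma setB5_subset_setB3 (r s t : ℕ → 𝕜) (hs : s 0 ≠ 0) (hp : ∀ k, 0 < p k)
    (hpb : BddAbove (Set.range p)) : setB5 r s t p ⊆ setB3 r t p := by
  intro a ha
  obtain ⟨M, hM⟩ := powBounded_iff.1 (show PowBounded p (E r s t a) from ha)
  obtain ⟨H, hH⟩ := hpb
  refine iSup_ofReal_lt_top_iff.2 ⟨max ‖s 0‖ 1 ^ H * M, fun k => ?_⟩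
  have h3 : r k * a k / t k = s 0 * E r s t a k k := by
    rw [E_self, mul_inv_cancel_left₀ hs]
  simp only [h3, norm_mul]
  rw [Real.mul_rpow (norm_nonneg _) (norm_nonneg _)]
  exact mul_le_mul (norm_rpow_le_of_norm_le (hp k) (hH ⟨k, rfl⟩) le_rfl) (hM k k)
    (Real.rpow_nonneg (norm_nonneg _) _) (by positivity)

lemma setB5_subset_setB7 (r s t : ℕ → 𝕜) (hp : ∀ k, 0 < p k) (hpb : BddAbove (Set.range p)) :
    setB5 r s t p ⊆ setB7 r s t p := by
  intro a ha L hL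
  obtain ⟨M, hM⟩ := powBounded_iff.1 (show PowBounded p (E r s t a) from ha)
  obtain ⟨H, hH⟩ := hpb
  -- B7 does not tie `α` to the column limits, so zero serves.
  refine ⟨0, iSup_iSup_ofReal_lt_top_iff.2 ⟨M * max (L : ℝ) 1 ^ H, fun m k => ?_⟩⟩
  have h := norm_rpow_le_of_norm_le (𝕜 := ℝ) (v := (L : ℝ)) (hp k) (hH ⟨k, rfl⟩) le_rfl
  simp only [Real.norm_natCast] at h
  simp only [Pi.zero_apply, sub_zero]
  rw [Real.mul_rpow (norm_nonneg _) (Nat.cast_nonneg _)]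
  exact mul_le_mul (hM m k) h (by positivity)
    ((Real.rpow_nonneg (norm_nonneg _) _).trans (hM m k))

end Conditions

/-! ### The β-dual and the matrix class into `l₁`. -/

section Duality

variable {𝕜 : Type*} [RCLike 𝕜] {r s t : ℕ → 𝕜} {p : ℕ → ℝ}

lemma rowSmall_E (hp : ∀ k, 0 < p k) (a : ℕ → 𝕜) (m : ℕ) : RowSmall p (E r s t a m) :=
  rowSmall_of_eventually_zero hp fun _ h => E_of_lt r s t a h

lemma partialSum_eq_tsum (hr : ∀ n, r n ≠ 0) (ht : ∀ n, t n ≠ 0) (hs : s 0 ≠ 0)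
    (a x : ℕ → 𝕜) (m : ℕ) : ∑ k ∈ Finset.range (m + 1), a k * x k =
      ∑' k, E r s t a m k * genMean r s t (diff x) k := by
  rw [sum_mul_eq_sum_E_mul r s t a x hr ht hs, tsum_eq_sum]
  intro k hk
  rw [E_of_lt r s t a (by simpa using hk), zero_mul]

lemma seriesConvTo_tsum (hr : ∀ n, r n ≠ 0) (ht : ∀ n, t n ≠ 0) (hs : s 0 ≠ 0)
    {a : ℕ → 𝕜} (hE : EquiSmall p (E r s t a)) {α : ℕ → 𝕜}
    (hα : ∀ k, Tendsto (fun m => E r s t a m k) atTop (𝓝 (α k)))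
    {x : ℕ → 𝕜} (hx : x ∈ lSpace r s t p) :
    SeriesConvTo (fun k => a k * x k) (∑' k, α k * genMean r s t (diff x) k) := by
  rw [SeriesConvTo]
  simp only [partialSum_eq_tsum hr ht hs]
  exact hE.tendsto_tsum hα hx

lemma mem_betaDual_of_equiSmall (hr : ∀ n, r n ≠ 0) (ht : ∀ n, t n ≠ 0) (hs : s 0 ≠ 0)
    {a : ℕ → 𝕜} (hE : EquiSmall p (E r s t a)) (ha : a ∈ setB6 r s t) :
    a ∈ betaDual (lSpace r s t p) := fun _ hx =>
  let ⟨_, hα⟩ := ha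
  ⟨_, seriesConvTo_tsum hr ht hs hE hα hx⟩

lemma exists_tendsto_tsum_of_mem_betaDual (hr : ∀ n, r n ≠ 0) (ht : ∀ n, t n ≠ 0) (hs : s 0 ≠ 0)
    {a : ℕ → 𝕜} (ha : a ∈ betaDual (lSpace r s t p)) {y : ℕ → 𝕜} (hy : y ∈ maddoxL p) :
    ∃ v, Tendsto (fun m => ∑' k, E r s t a m k * y k) atTop (𝓝 v) := by
  obtain ⟨x, rfl⟩ := exists_genMean_diff_eq r s t hr ht hs y
  obtain ⟨v, hv⟩ := ha x hy
  exact ⟨v, by simpa only [SeriesConvTo, partialSum_eq_tsum hr ht hs] using hv⟩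

/-- Tested on the `k`-th unit vector, the convergent sums reduce to column `k` of `E`. -/
lemma mem_setB6_of_mem_betaDual (hr : ∀ n, r n ≠ 0) (ht : ∀ n, t n ≠ 0) (hs : s 0 ≠ 0)
    (hp : ∀ k, 0 < p k) {a : ℕ → 𝕜} (ha : a ∈ betaDual (lSpace r s t p)) : a ∈ setB6 r s t := by
  refine ⟨_, fun k => Classical.choose_spec (p := fun v => Tendsto _ atTop (𝓝 v)) ?_⟩
  obtain ⟨v, hv⟩ := exists_tendsto_tsum_of_mem_betaDual hr ht hs ha
    (y := fun j => if j = k then 1 else 0) (by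
      refine summable_of_ne_finset_zero (s := {k}) fun j hj => ?_
      have : j ≠ k := by simpa using hj
      simp [this, Real.zero_rpow (hp j).ne'])
  exact ⟨v, by simpa using hv⟩

lemma bddNearZero_of_mem_betaDual (hr : ∀ n, r n ≠ 0) (ht : ∀ n, t n ≠ 0) (hs : s 0 ≠ 0)
    (hp : ∀ k, 0 < p k) {a : ℕ → 𝕜} (ha : a ∈ betaDual (lSpace r s t p)) :
    BddNearZero p (E r s t a) := by
  refine bddNearZero_of_pointwise_bounded hp (rowSmall_E hp a) fun y hy => ?_
  obtain ⟨v, hv⟩ := exists_tendsto_tsum_of_mem_betaDual hr ht hs ha hy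
  obtain ⟨B, hB⟩ := hv.norm.bddAbove_range
  exact ⟨B, fun m => hB ⟨m, rfl⟩⟩

lemma tendsto_Etilde {A : ℕ → ℕ → 𝕜} {n : ℕ} (h : A n ∈ setB6 r s t) (k : ℕ) :
    Tendsto (fun m => E r s t (A n) m k) atTop (𝓝 (Etilde r s t A n k)) :=
  let ⟨α, hα⟩ := h
  tendsto_nhds_limUnder ⟨α k, hα k⟩

lemma tsum_sum_Etilde {A : ℕ → ℕ → 𝕜} (hE : ∀ n, EquiSmall p (E r s t (A n)))
    (hB6 : ∀ n, A n ∈ setB6 r s t) {y : ℕ → 𝕜} (hy : y ∈ maddoxL p) (F : Finset ℕ) :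
    ∑' k, (∑ n ∈ F, Etilde r s t A n k) * y k = ∑ n ∈ F, ∑' k, Etilde r s t A n k * y k := by
  simp only [Finset.sum_mul]
  exact Summable.tsum_finsetSum fun n _ =>
    (((hE n).rowSmall_of_tendsto (tendsto_Etilde (hB6 n))).summable_norm hy ()).of_norm

/-- For fixed `y` the functional of `F` is a partial sum of `A x`, so `∑ ‖z n‖` bounds it for all
`F` and uniform boundedness applies. -/
lemma bddNearZero_of_mem_matrixClass (hr : ∀ n, r n ≠ 0) (ht : ∀ n, t n ≠ 0) (hs : s 0 ≠ 0)
    (hp : ∀ k, 0 < p k) {A : ℕ → ℕ → 𝕜} (hA : A ∈ matrixClass (lSpace r s t p) ell1)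
    (hE : ∀ n, EquiSmall p (E r s t (A n))) (hB6 : ∀ n, A n ∈ setB6 r s t) :
    BddNearZero p fun (F : Finset ℕ) k => ∑ n ∈ F, Etilde r s t A n k := by
  refine bddNearZero_of_pointwise_bounded hp
    (fun F => RowSmall.sum (fun n => (hE n).rowSmall_of_tendsto (tendsto_Etilde (hB6 n))) F)
    fun y hy => ?_
  obtain ⟨x, rfl⟩ := exists_genMean_diff_eq r s t hr ht hs y
  obtain ⟨z, hz, hconv⟩ := hA x hy
  refine ⟨∑' n, ‖z n‖, fun F => ?_⟩
  rw [tsum_sum_Etilde hE hB6 hy]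
  have hzn : ∀ n, ∑' k, Etilde r s t A n k * genMean r s t (diff x) k = z n := fun n =>
    tendsto_nhds_unique (seriesConvTo_tsum hr ht hs (hE n) (tendsto_Etilde (hB6 n)) hy) (hconv n)
  simp only [hzn]
  exact (norm_sum_le _ _).trans (Summable.sum_le_tsum F (fun _ _ => norm_nonneg _) hz)

lemma summable_abs_of_bounded_sums {f : ℕ → ℝ} {B : ℝ} (h : ∀ F : Finset ℕ, |∑ n ∈ F, f n| ≤ B) :
    Summable fun n => |f n| := by
  refine summable_of_sum_le (c := 2 * B) (fun _ => abs_nonneg _) fun F => ?_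
  -- The nonnegative and the negative terms each form a finite subsum bounded by `B`, whence `2 *
  -- B`.
  rw [← Finset.sum_filter_add_sum_filter_not F (fun n => 0 ≤ f n)]
  have h1 : ∑ n ∈ F with 0 ≤ f n, |f n| = ∑ n ∈ F with 0 ≤ f n, f n :=
    Finset.sum_congr rfl fun n hn => abs_of_nonneg (Finset.mem_filter.1 hn).2
  have h2 : ∑ n ∈ F with ¬ 0 ≤ f n, |f n| = -∑ n ∈ F with ¬ 0 ≤ f n, f n := by
    rw [← Finset.sum_neg_distrib]
    exact Finset.sum_congr rfl fun n hn => abs_of_neg (not_le.1 (Finset.mem_filter.1 hn).2)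
  rw [h1, h2]
  linarith [le_abs_self (∑ n ∈ F with 0 ≤ f n, f n), h (F.filter fun n => 0 ≤ f n),
    neg_le_abs (∑ n ∈ F with ¬ 0 ≤ f n, f n), h (F.filter fun n => ¬ 0 ≤ f n)]

lemma mem_ell1_of_bounded_sums {z : ℕ → 𝕜} {B : ℝ} (h : ∀ F : Finset ℕ, ‖∑ n ∈ F, z n‖ ≤ B) :
    z ∈ ell1 := by
  have h1 : Summable fun n => |RCLike.re (z n)| := summable_abs_of_bounded_sums (B := B) fun F => by
    rw [← map_sum]
    exact (RCLike.abs_re_le_norm _).trans (h F)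
  have h2 : Summable fun n => |RCLike.im (z n)| := summable_abs_of_bounded_sums (B := B) fun F => by
    rw [← map_sum]
    exact (RCLike.abs_im_le_norm _).trans (h F)
  refine Summable.of_nonneg_of_le (fun _ => norm_nonneg _)
    (fun n => ?_) (h1.add h2)
  rw [← abs_norm]
  refine abs_le_of_sq_le_sq ?_ (by positivity)
  rw [RCLike.norm_sq_eq_def]
  nlinarith [sq_abs (RCLike.re (z n)), sq_abs (RCLike.im (z n)),
    mul_nonneg (abs_nonneg (RCLike.re (z n))) (abs_nonneg (RCLike.im (z n)))]

lemma mem_matrixClass_of_equiSmall (hr : ∀ n, r n ≠ 0) (ht : ∀ n, t n ≠ 0) (hs : s 0 ≠ 0)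
    (hp : ∀ k, 0 < p k) {A : ℕ → ℕ → 𝕜} (hE : ∀ n, EquiSmall p (E r s t (A n)))
    (hB6 : ∀ n, A n ∈ setB6 r s t)
    (hF : EquiSmall p fun (F : Finset ℕ) k => ∑ n ∈ F, Etilde r s t A n k) :
    A ∈ matrixClass (lSpace r s t p) ell1 := by
  intro x hx
  refine ⟨fun n => ∑' k, Etilde r s t A n k * genMean r s t (diff x) k, ?_,
    fun n => seriesConvTo_tsum hr ht hs (hE n) (tendsto_Etilde (hB6 n)) hx⟩
  obtain ⟨B, hB⟩ := hF.exists_bound hp hx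
  exact mem_ell1_of_bounded_sums (B := B) fun F => by
    rw [← tsum_sum_Etilde hE hB6 hx]
    exact hB F

lemma mem_betaDual_of_mem_matrixClass {U V : Set (ℕ → 𝕜)} {A : ℕ → ℕ → 𝕜}
    (hA : A ∈ matrixClass U V) (n : ℕ) : A n ∈ betaDual U := fun x hx =>
  let ⟨z, _, hz⟩ := hA x hx
  ⟨z n, hz n⟩

/-- Membership in `(l(r, s, t, p; Δ), l₁)`, for any condition `Q` on families of coefficient
sequences that lies between boundedness near zero and equicontinuity. -/
lemma mem_matrixClass_iff (hr : ∀ n, r n ≠ 0) (ht : ∀ n, t n ≠ 0) (hs : s 0 ≠ 0)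
    (hp : ∀ k, 0 < p k) {Q : ∀ {ι : Type}, (ι → ℕ → 𝕜) → Prop}
    (hbQ : ∀ {ι : Type} (c : ι → ℕ → 𝕜), BddNearZero p c → Q c)
    (hQe : ∀ {ι : Type} (c : ι → ℕ → 𝕜), Q c → EquiSmall p c) (A : ℕ → ℕ → 𝕜) :
    A ∈ matrixClass (lSpace r s t p) ell1 ↔
      Q (fun (F : Finset ℕ) k => ∑ n ∈ F, Etilde r s t A n k) ∧
        ∀ n, A n ∈ betaDual (lSpace r s t p) := by
  -- Here `Q` is used with index set `ℕ`, for the partial-sum functionals of one row; below it is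
  -- used with finite sets of rows.
  have hE : (∀ n, A n ∈ betaDual (lSpace r s t p)) → ∀ n, EquiSmall p (E r s t (A n)) :=
    fun h n => hQe _ (hbQ _ (bddNearZero_of_mem_betaDual hr ht hs hp (h n)))
  constructor
  · intro hA
    have hrow := fun n => mem_betaDual_of_mem_matrixClass hA n
    exact ⟨hbQ _ (bddNearZero_of_mem_matrixClass hr ht hs hp hA (hE hrow)
      fun n => mem_setB6_of_mem_betaDual hr ht hs hp (hrow n)), hrow⟩
  · rintro ⟨hQ, hrow⟩
    exact mem_matrixClass_of_equiSmall hr ht hs hp (hE hrow)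
      (fun n => mem_setB6_of_mem_betaDual hr ht hs hp (hrow n)) (hQe _ hQ)

end Duality

end GenMeans


theorem theorem4p7 {𝕜 : Type*} [RCLike 𝕜] (r s t : ℕ → 𝕜) (p : ℕ → ℝ)
    (hr : ∀ n, r n ≠ 0) (ht : ∀ n, t n ≠ 0) (hs : s 0 ≠ 0)
    (hp : ∀ k, 0 < p k) (hpb : BddAbove (Set.range p)) (A : ℕ → ℕ → 𝕜) :
    ((∀ k, 1 < p k) →
      GenMeans.betaDual (GenMeans.lSpace r s t p) =
          GenMeans.setB3 r t p ∩ GenMeans.setB4 r s t p ∩ GenMeans.setB6 r s t ∧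
        (A ∈ GenMeans.matrixClass (GenMeans.lSpace r s t p) GenMeans.ell1 ↔
          (∃ L : ℕ, 0 < L ∧
            (⨆ F : Finset ℕ, ∑' k, ENNReal.ofReal
              (‖∑ n ∈ F, GenMeans.Etilde r s t A n k * (L : 𝕜)⁻¹‖ ^
                GenMeans.conjExp (p k))) < ⊤) ∧
          ∀ n, A n ∈ GenMeans.betaDual (GenMeans.lSpace r s t p))) ∧
    ((∀ k, p k ≤ 1) →
      GenMeans.betaDual (GenMeans.lSpace r s t p) =
          GenMeans.setB3 r t p ∩ GenMeans.setB5 r s t p ∩ GenMeans.setB6 r s t ∩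
            GenMeans.setB7 r s t p ∧
        (A ∈ GenMeans.matrixClass (GenMeans.lSpace r s t p) GenMeans.ell1 ↔
          ((⨆ F : Finset ℕ, ⨆ k, ENNReal.ofReal
              (‖∑ n ∈ F, GenMeans.Etilde r s t A n k‖ ^ p k)) < ⊤) ∧
          ∀ n, A n ∈ GenMeans.betaDual (GenMeans.lSpace r s t p))) := by

  constructor
  · intro hp1
    refine ⟨Set.Subset.antisymm (fun a ha => ?_) (fun a ha => ?_), ?_⟩
    · have h4 : a ∈ GenMeans.setB4 r s t p :=
        (GenMeans.bddNearZero_of_mem_betaDual hr ht hs hp ha).conjBounded hp1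
      exact ⟨⟨GenMeans.setB4_subset_setB3 r s t hs hp1 hpb h4, h4⟩,
        GenMeans.mem_setB6_of_mem_betaDual hr ht hs hp ha⟩
    · have h4 : GenMeans.ConjBounded p (GenMeans.E r s t a) := ha.1.2
      exact GenMeans.mem_betaDual_of_equiSmall hr ht hs (h4.equiSmall hp1 hpb) ha.2
    · rw [GenMeans.mem_matrixClass_iff hr ht hs hp (Q := fun c => GenMeans.ConjBounded p c)
        (fun c h => h.conjBounded hp1) (fun c h => h.equiSmall hp1 hpb) A]
      simp only [GenMeans.ConjBounded, Finset.sum_mul]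
  · intro hp1
    refine ⟨Set.Subset.antisymm (fun a ha => ?_) (fun a ha => ?_), ?_⟩
    · have h5 : a ∈ GenMeans.setB5 r s t p :=
        (GenMeans.bddNearZero_of_mem_betaDual hr ht hs hp ha).powBounded hp hp1
      exact ⟨⟨⟨GenMeans.setB5_subset_setB3 r s t hs hp hpb h5, h5⟩,
        GenMeans.mem_setB6_of_mem_betaDual hr ht hs hp ha⟩,
        GenMeans.setB5_subset_setB7 r s t hp hpb h5⟩
    · have h5 : GenMeans.PowBounded p (GenMeans.E r s t a) := ha.1.1.2
      exact GenMeans.mem_betaDual_of_equiSmall hr ht hs (h5.equiSmall hp hp1) ha.1.2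
    · rw [GenMeans.mem_matrixClass_iff hr ht hs hp (Q := fun c => GenMeans.PowBounded p c)
        (fun c h => h.powBounded hp hp1) (fun c h => h.equiSmall hp hp1) A]
      rfl
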